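/- Let $(X,\mathcal F,\mu)$ be a $\sigma$-finite measure space and $\mathcal A\subseteq\mathcal F$ a $\sigma$-subalgebra such that $\mu|_{\mathcal A}$ is $\sigma$-finite. Let $E$ be the conditional expectation with respect to $\mathcal A$, defined for all $\mathcal F$-measurable $f\ge 0$ with values in $[0,\infty]$ and, by linearity, on $\mathcal D(E)$, the set of all $\mathcal F$-measurable $f:X\to\mathbb C$ with $E(|f|)<\infty$ a.e. Functions are identified when they agree almost everywhere, and $L^2(\mathcal F)=L^2(X,\mathcal F,\mu)$ is the complex Hilbert space. For a bounded operator $T$ on a complex Hilbert space $\mathcal H$ with spectral radius $r(T)$ and for $m\ge1$, put $$d_m=\frac1{\frac1m+r(T)},\qquad R_m=\Big(\sum_{n=0}^\infty d_m^{2n}\,T^{*n}T^n\Big)^{1/2},$$ (the series converges in norm and $R_m$ is positive and invertible), and let $$Q_T=\{S\in\mathcal B(\mathcal H):\ \|R_mSR_m^{-1}\|\to0\ \text{ as } m\to\infty\}.$$ Let $w,u\in\mathcal D(E)$ with $E(|u|^2)\in L^\infty(\mathcal A)$, and suppose that $T=M_wEM_u$, $Tf=wE(uf)$, is a bounded operator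 on $L^2(\mathcal F)$. Suppose that $u\ge0$ a.e. and that $E(u)\ge\delta$ a.e. for some constant $\delta>0$. Then $EM_u$, $f\mapsto E(uf)$, is a bounded operator on $L^2(\mathcal F)$, and it majorizes every $S\in Q_T$: for every $S\in Q_T$ there is a constant $M>0$ such that $$\|Sf\|\le M\,\|E(uf)\|\qquad\text{for all } f\in L^2(\mathcal F).$$ -/

import Mathlib

open MeasureTheory Filter Topology
open scoped ENNReal NNReal ComplexOrder

noncomputable section

namespace SpectralRadiusAlgebra

section Hilbert

variable {H : Type*} [NormedAddCommGroup H] [InnerProductSpace ℂ H] [CompleteSpace H]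

/-- The scalar `d_m = 1 / (1/m + r(T))`, where `r(T)` is the spectral radius of `T`. -/
def dCoeff (T : H →L[ℂ] H) (m : ℕ) : ℝ :=
  1 / (1 / (m : ℝ) + (spectralRadius ℂ T).toReal)

/-- The positive operator `R_m(T) = (∑ₙ d_m ^ (2n) (T*)ⁿ Tⁿ) ^ (1/2)`; for `m ≥ 1` the series
converges in operator norm. -/
def Rop (T : H →L[ℂ] H) (m : ℕ) : H →L[ℂ] H :=
  CFC.sqrt (∑' n : ℕ, ((dCoeff T m : ℂ) ^ (2 * n)) • ((ContinuousLinearMap.adjoint T) ^ n * T ^ n))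

/-- `Q_T`: the bounded operators `S` on `H` with `‖R_m S R_m⁻¹‖ → 0` as `m → ∞`. -/
def Qset (T : H →L[ℂ] H) : Set (H →L[ℂ] H) :=
  {S | Tendsto (fun m : ℕ => ‖Rop T m * S * Ring.inverse (Rop T m)‖) atTop (𝓝 0)}

end Hilbert

/-- `T` majorizes `S`: there is `M > 0` with `‖S x‖ ≤ M ‖T x‖` for all `x`. -/
def Majorizes {E F G : Type*} [NormedAddCommGroup E] [NormedSpace ℂ E]
    [NormedAddCommGroup F] [NormedSpace ℂ F] [NormedAddCommGroup G] [NormedSpace ℂ G]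
    (T : E →L[ℂ] F) (S : E →L[ℂ] G) : Prop :=
  ∃ M : ℝ, 0 < M ∧ ∀ x : E, ‖S x‖ ≤ M * ‖T x‖

section CondExp

variable {X : Type*} {mF : MeasurableSpace X}

/-- `f ∈ 𝓓(E)`: `f` is measurable (up to null sets) and `E(|f|) < ∞` almost everywhere.
Here `condLExp mA μ` is the conditional expectation of `[0, ∞]`-valued functions. -/
def Conditionable (mA : MeasurableSpace X) (μ : Measure[mF] X) (f : X → ℂ) : Prop :=
  AEStronglyMeasurable[mF] f μ ∧ ∀ᵐ x ∂μ, condLExp mA μ (fun y => ‖f y‖ₑ) x < ∞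

/-- The conditional expectation `E(f)` of a real function with `E(|f|) < ∞` a.e. (`f` need not be
integrable), namely `E(f⁺) - E(f⁻)`. -/
def condEReal (mA : MeasurableSpace X) (μ : Measure[mF] X) (f : X → ℝ) (x : X) : ℝ :=
  (condLExp mA μ (fun y => ENNReal.ofReal (f y)) x).toReal -
    (condLExp mA μ (fun y => ENNReal.ofReal (-f y)) x).toReal

/-- The conditional expectation `E(f) = E(Re f) + i E(Im f)` of a complex function in `𝓓(E)`. -/
def condE (mA : MeasurableSpace X) (μ : Measure[mF] X) (f : X → ℂ) (x : X) : ℂ :=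
  ⟨condEReal mA μ (fun y => (f y).re) x, condEReal mA μ (fun y => (f y).im) x⟩

/-- The bounded operator `T` on `L²(μ)` is the weighted conditional expectation operator
`M_w E M_u`, that is, `T f = w E(u f)` for every `f ∈ L²(μ)`. -/
def IsWCE (mA : MeasurableSpace X) (μ : Measure[mF] X) (w u : X → ℂ)
    (T : Lp ℂ 2 μ →L[ℂ] Lp ℂ 2 μ) : Prop :=
  ∀ f : Lp ℂ 2 μ, Conditionable mA μ (fun x => u x * f x) ∧
    T f =ᵐ[μ] fun x => w x * condE mA μ (fun y => u y * f y) x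

end CondExp

end SpectralRadiusAlgebra

end

/-! Two facts combine. First, every `S ∈ Q_T` kills `ker T`. The `n = 0` term of the series is the
identity and the others are positive, so `R_m² ≥ 1` and `‖y‖ ≤ ‖R_m y‖` for all `y`; if `T x = 0`,
only the `n = 0` term survives at `x`, so `‖R_m x‖ = ‖x‖`. Hence `‖S x‖ ≤ ‖R_m S R_m⁻¹ (R_m x)‖ ≤
‖R_m S R_m⁻¹‖ ‖x‖ → 0` (`apply_eq_zero_of_mem_Qset`).

Second, modulo `ker T` every `f` is represented by `g = E(u f) / E(u)`. This `g` is `mA`-measurable,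
so `E(u g) = g E(u) = E(u f)` and `T (f - g) = 0`, while `|g| ≤ δ⁻¹ |E(u f)|`. Therefore `‖S f‖ = ‖S
g‖ ≤ ‖S‖ δ⁻¹ ‖E(u f)‖` (`IsWCE.exists_norm_le`, `IsWCE.majorizes`).

Boundedness of `E M_u` is a conditional Cauchy-Schwarz estimate (`lintegral_condLExp_mul_sq_le`).
Since `u` and `E(u f) / E(u)` need be neither integrable nor bounded, linearity and the pull-out
property are derived from the `[0, ∞]`-valued expectation. -/

namespace SpectralRadiusAlgebra

/-! ### Operators in `Q_T` vanish on the kernel of `T`. -/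

section Hilbert

variable {H : Type*} [NormedAddCommGroup H] [InnerProductSpace ℂ H]

lemma dCoeff_pos (T : H →L[ℂ] H) {m : ℕ} (hm : 1 ≤ m) : 0 < dCoeff T m := by
  have : (0 : ℝ) < m := by exact_mod_cast hm
  unfold dCoeff
  positivity

lemma dCoeff_mul_spectralRadius_lt_one (T : H →L[ℂ] H) {m : ℕ} (hm : 1 ≤ m) :
    (spectralRadius ℂ T).toReal * dCoeff T m < 1 := by
  have : (0 : ℝ) < m := by exact_mod_cast hm
  have h : 0 < 1 / (m : ℝ) := by positivity
  have h2 : 0 ≤ (spectralRadius ℂ T).toReal := ENNReal.toReal_nonneg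
  rw [dCoeff, mul_one_div, div_lt_one (by positivity)]
  linarith

variable [CompleteSpace H]

/-- Guards against the junk value `(∞).toReal = 0` in `dCoeff`. -/
lemma spectralRadius_ne_top (T : H →L[ℂ] H) : spectralRadius ℂ T ≠ ∞ := by
  have h := spectrum.spectralRadius_le_pow_nnnorm_pow_one_div ℂ T 0
  refine ne_top_of_le_ne_top ?_ h
  simp [ENNReal.mul_ne_top]

/-- The terms of the series defining `R_m ^ 2` are summable, by Gelfand's formula. -/
lemma summable_dCoeff_pow_smul (T : H →L[ℂ] H) {m : ℕ} (hm : 1 ≤ m) :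
    Summable fun n : ℕ =>
      ((dCoeff T m : ℂ) ^ (2 * n)) • ((ContinuousLinearMap.adjoint T) ^ n * T ^ n) := by
  have hd := dCoeff_pos T hm
  set d := dCoeff T m with hd_def
  -- Any `a` strictly between `r(T)` and `1 / d` works: eventually `‖T ^ n‖ ≤ a ^ n`, so the series
  -- is dominated by a geometric one of ratio `(a * d) ^ 2 < 1`.
  obtain ⟨a, ha1, ha2⟩ : ∃ a : ℝ, (spectralRadius ℂ T).toReal < a ∧ a * d < 1 := by
    have h := dCoeff_mul_spectralRadius_lt_one T hm
    rw [← lt_div_iff₀ hd] at h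
    obtain ⟨a, h1, h2⟩ := exists_between h
    exact ⟨a, h1, (lt_div_iff₀ hd).1 h2⟩
  have ha0 : 0 < a := ENNReal.toReal_nonneg.trans_lt ha1
  have hev : ∀ᶠ n : ℕ in atTop, ‖T ^ n‖ ≤ a ^ n := by
    have h := spectrum.pow_norm_pow_one_div_tendsto_nhds_spectralRadius T
    have hlt : spectralRadius ℂ T < ENNReal.ofReal a :=
      (ENNReal.lt_ofReal_iff_toReal_lt (spectralRadius_ne_top T)).2 ha1
    filter_upwards [h.eventually_lt_const hlt, eventually_ge_atTop 1] with n hn hn1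
    have h1 : ‖T ^ n‖ ^ (1 / n : ℝ) < a := (ENNReal.ofReal_lt_ofReal_iff ha0).1 hn
    have h2 : ‖T ^ n‖ = (‖T ^ n‖ ^ (1 / n : ℝ)) ^ n := by
      rw [one_div, Real.rpow_inv_natCast_pow (norm_nonneg _) (by omega)]
    rw [h2]
    gcongr
  refine Summable.of_norm_bounded_eventually_nat (g := fun n => ((a * d) ^ 2) ^ n) ?_ ?_
  · exact summable_geometric_of_lt_one (by positivity)
      (pow_lt_one₀ (by positivity) ha2 two_ne_zero)
  · filter_upwards [hev] with n hn
    have h3 : ‖(ContinuousLinearMap.adjoint T) ^ n‖ = ‖T ^ n‖ := by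
      rw [← ContinuousLinearMap.star_eq_adjoint, ← star_pow, norm_star]
    calc ‖((d : ℂ) ^ (2 * n)) • ((ContinuousLinearMap.adjoint T) ^ n * T ^ n)‖
        = d ^ (2 * n) * ‖(ContinuousLinearMap.adjoint T) ^ n * T ^ n‖ := by
          rw [norm_smul, norm_pow, Complex.norm_real, Real.norm_of_nonneg hd.le]
      _ ≤ d ^ (2 * n) * (a ^ n * a ^ n) := by
          gcongr
          refine (norm_mul_le _ _).trans ?_
          rw [h3]
          gcongr
      _ = ((a * d) ^ 2) ^ n := by ring

/-- The square of `R_m`. -/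
noncomputable def RopSq (T : H →L[ℂ] H) (m : ℕ) : H →L[ℂ] H :=
  ∑' n : ℕ, ((dCoeff T m : ℂ) ^ (2 * n)) • ((ContinuousLinearMap.adjoint T) ^ n * T ^ n)

/-- The `n = 0` term is `1`, and each later term has the form `star B * B`. -/
lemma one_le_RopSq (T : H →L[ℂ] H) {m : ℕ} (hm : 1 ≤ m) : 1 ≤ RopSq T m := by
  have hs := summable_dCoeff_pow_smul T hm
  rw [RopSq, hs.tsum_eq_zero_add]
  simp only [mul_zero, pow_zero, mul_one, one_smul, le_add_iff_nonneg_right]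
  refine tsum_nonneg fun n => ?_
  have : ((dCoeff T m : ℂ) ^ (2 * (n + 1))) •
      ((ContinuousLinearMap.adjoint T) ^ (n + 1) * T ^ (n + 1)) =
      star (((dCoeff T m : ℂ) ^ (n + 1)) • T ^ (n + 1)) *
        (((dCoeff T m : ℂ) ^ (n + 1)) • T ^ (n + 1)) := by
    rw [star_smul, star_pow, star_pow, ← ContinuousLinearMap.star_eq_adjoint, smul_mul_smul_comm]
    congr 1
    simp [two_mul, pow_add]
  rw [this]
  exact star_mul_self_nonneg _

lemma Rop_mul_self (T : H →L[ℂ] H) {m : ℕ} (hm : 1 ≤ m) : Rop T m * Rop T m = RopSq T m :=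
  CFC.sqrt_mul_sqrt_self _ (zero_le_one.trans (one_le_RopSq T hm))

/-- Makes `Ring.inverse (Rop T m)` a genuine inverse rather than the default value `0`. -/
lemma isUnit_Rop (T : H →L[ℂ] H) {m : ℕ} (hm : 1 ≤ m) : IsUnit (Rop T m) :=
  (CFC.isUnit_sqrt_iff _ (zero_le_one.trans (one_le_RopSq T hm))).2
    (CStarAlgebra.isUnit_of_le 1 (one_le_RopSq T hm))

lemma norm_Rop_apply_sq (T : H →L[ℂ] H) {m : ℕ} (hm : 1 ≤ m) (x : H) :
    ‖Rop T m x‖ ^ 2 = RCLike.re (inner ℂ (RopSq T m x) x) := by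
  have hsa : IsSelfAdjoint (Rop T m) := .of_nonneg (CFC.sqrt_nonneg _)
  rw [← Rop_mul_self T hm, mul_apply_eq_comp,
    ← ContinuousLinearMap.adjoint_inner_right, hsa.adjoint_eq, inner_self_eq_norm_sq]

lemma norm_le_norm_Rop_apply (T : H →L[ℂ] H) {m : ℕ} (hm : 1 ≤ m) (x : H) :
    ‖x‖ ≤ ‖Rop T m x‖ := by
  refine (sq_le_sq₀ (norm_nonneg _) (norm_nonneg _)).1 ?_
  rw [norm_Rop_apply_sq T hm]
  have h := ((ContinuousLinearMap.le_def _ _).1 (one_le_RopSq T hm)).re_inner_nonneg_left x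
  rw [sub_apply, inner_sub_left, map_sub, one_apply_eq_self,
    inner_self_eq_norm_sq, sub_nonneg] at h
  exact h

/-- On `ker T` every term with `n ≥ 1` vanishes, so `R_m²` fixes `x`. -/
lemma norm_Rop_apply_of_apply_eq_zero (T : H →L[ℂ] H) {m : ℕ} (hm : 1 ≤ m) {x : H}
    (hx : T x = 0) : ‖Rop T m x‖ = ‖x‖ := by
  have h : RopSq T m x = x := by
    have hs := (summable_dCoeff_pow_smul T hm).hasSum.mapL (ContinuousLinearMap.apply ℂ H x)
    refine hs.unique ?_
    convert hasSum_single 0 fun n hn => ?_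
    · simp
    · obtain ⟨k, rfl⟩ := Nat.exists_eq_succ_of_ne_zero hn
      simp [pow_succ, hx]
  have := norm_Rop_apply_sq T hm x
  rw [h, inner_self_eq_norm_sq] at this
  exact (pow_left_inj₀ (norm_nonneg _) (norm_nonneg _) two_ne_zero).1 this

/-- Every operator in `Q_T` vanishes on the kernel of `T`. -/
lemma apply_eq_zero_of_mem_Qset {T S : H →L[ℂ] H} (hS : S ∈ Qset T) {x : H} (hx : T x = 0) :
    S x = 0 := by
  have h1 : Tendsto (fun m : ℕ => ‖Rop T m * S * Ring.inverse (Rop T m)‖ * ‖x‖) atTop (𝓝 0) := by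
    simpa using Tendsto.mul_const ‖x‖ hS
  have h2 : ∀ᶠ m : ℕ in atTop, ‖S x‖ ≤ ‖Rop T m * S * Ring.inverse (Rop T m)‖ * ‖x‖ := by
    filter_upwards [eventually_ge_atTop 1] with m hm
    calc ‖S x‖ ≤ ‖Rop T m (S x)‖ := norm_le_norm_Rop_apply T hm _
      _ = ‖(Rop T m * S * Ring.inverse (Rop T m)) (Rop T m x)‖ := by
        rw [← mul_apply_eq_comp (_ * _ * _), mul_assoc,
          Ring.inverse_mul_cancel _ (isUnit_Rop T hm), mul_one, mul_apply_eq_comp]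
      _ ≤ ‖Rop T m * S * Ring.inverse (Rop T m)‖ * ‖Rop T m x‖ :=
        ContinuousLinearMap.le_opNorm _ _
      _ = _ := by rw [norm_Rop_apply_of_apply_eq_zero T hm hx]
  exact norm_le_zero_iff.1 (ge_of_tendsto h1 h2)

end Hilbert

/-! ### Calculus of the conditional expectation: pull-out, linearity, modulus bound. -/

section CondExp

variable {X : Type*} {mA mF : MeasurableSpace X} {μ : Measure X}

/-- For indicators of `mA`-sets this is the defining property of `condLExp`; sums and monotone
limits extend it, with no finiteness needed. -/
lemma lintegral_mul_condLExp (hA : mA ≤ mF) [SigmaFinite (μ.trim hA)] {h f : X → ℝ≥0∞}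
    (hh : Measurable[mA] h) (hf : AEMeasurable f μ) :
    ∫⁻ x, h x * condLExp mA μ f x ∂μ = ∫⁻ x, h x * f x ∂μ := by
  refine Measurable.ennreal_induction (mα := mA) (motive := fun h =>
    ∫⁻ x, h x * condLExp mA μ f x ∂μ = ∫⁻ x, h x * f x ∂μ) ?_ ?_ ?_ hh
  · intro c s hs
    have e (k : X → ℝ≥0∞) (x : X) :
        s.indicator (fun _ => c) x * k x = s.indicator (fun y => c * k y) x := by
      by_cases hx : x ∈ s <;> simp [hx]
    simp_rw [e]
    rw [lintegral_indicator (hA s hs), lintegral_indicator (hA s hs),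
      lintegral_const_mul'' _ (by fun_prop), lintegral_const_mul'' _ hf.restrict,
      setLIntegral_condLExp hA μ f hs]
  · intro g k _ hg hk ihg ihk
    have hg' : Measurable g := hg.mono hA le_rfl
    simp only [Pi.add_apply, add_mul]
    rw [lintegral_add_left (by fun_prop), lintegral_add_left' (by fun_prop), ihg, ihk]
  · intro g hg hmono ih
    have hg' (n : ℕ) : Measurable (g n) := (hg n).mono hA le_rfl
    simp only [ENNReal.iSup_mul]
    rw [lintegral_iSup (by fun_prop) fun i j hij x => by gcongr; exact hmono hij x,
      lintegral_iSup' (by fun_prop)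
        (.of_forall fun x i j hij => by dsimp only; gcongr; exact hmono hij x)]
    simp_rw [ih]

/-- The pull-out property of the `[0, ∞]`-valued conditional expectation. -/
lemma condLExp_mul (hA : mA ≤ mF) [SigmaFinite (μ.trim hA)] {h f : X → ℝ≥0∞}
    (hh : Measurable[mA] h) (hf : AEMeasurable f μ) :
    condLExp mA μ (fun x => h x * f x) =ᵐ[μ] fun x => h x * condLExp mA μ f x := by
  refine (ae_eq_condLExp hA μ _ (hh.mul (measurable_condLExp mA μ f)) fun s hs => ?_).symm
  have e (k : X → ℝ≥0∞) :
      s.indicator (fun y => h y * k y) = fun x => s.indicator h x * k x := by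
    ext x
    by_cases hx : x ∈ s <;> simp [hx]
  rw [← lintegral_indicator (hA s hs), ← lintegral_indicator (hA s hs), e f]
  refine .trans (congrArg _ (e (condLExp mA μ f))) ?_
  exact lintegral_mul_condLExp hA (hh.indicator hs) hf

lemma condLExp_add {p q : X → ℝ≥0∞} (hp : AEMeasurable p μ) :
    condLExp mA μ (fun x => p x + q x) =ᵐ[μ] fun x => condLExp mA μ p x + condLExp mA μ q x :=
  condLExp_add_left q hp

lemma condEReal_congr_ae {f g : X → ℝ} (h : f =ᵐ[μ] g) :
    condEReal mA μ f =ᵐ[μ] condEReal mA μ g := by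
  have h1 : (fun y => ENNReal.ofReal (f y)) =ᵐ[μ] fun y => ENNReal.ofReal (g y) := by
    filter_upwards [h] with x hx using by rw [hx]
  have h2 : (fun y => ENNReal.ofReal (-f y)) =ᵐ[μ] fun y => ENNReal.ofReal (-g y) := by
    filter_upwards [h] with x hx using by rw [hx]
  filter_upwards [condLExp_congr_ae (mΩ := mA) h1, condLExp_congr_ae (mΩ := mA) h2] with x h1 h2
  rw [condEReal, condEReal, h1, h2]

lemma condE_congr_ae {f g : X → ℂ} (h : f =ᵐ[μ] g) : condE mA μ f =ᵐ[μ] condE mA μ g := by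
  have h1 : (fun y => (f y).re) =ᵐ[μ] fun y => (g y).re := by
    filter_upwards [h] with x hx using by rw [hx]
  have h2 : (fun y => (f y).im) =ᵐ[μ] fun y => (g y).im := by
    filter_upwards [h] with x hx using by rw [hx]
  filter_upwards [condEReal_congr_ae (mA := mA) h1, condEReal_congr_ae (mA := mA) h2] with x h1 h2
  rw [condE, condE, h1, h2]

lemma measurable_condEReal (f : X → ℝ) : Measurable[mA] (condEReal mA μ f) :=
  (measurable_condLExp mA μ _).ennreal_toReal.sub (measurable_condLExp mA μ _).ennreal_toReal

lemma measurable_condE (f : X → ℂ) : Measurable[mA] (condE mA μ f) := by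
  have h : condE mA μ f = fun x =>
      (condEReal mA μ (fun y => (f y).re) x : ℂ) +
        (condEReal mA μ (fun y => (f y).im) x : ℂ) * Complex.I := by
    ext x
    exact (Complex.re_add_im (condE mA μ f x)).symm
  rw [h]
  exact (Complex.measurable_ofReal.comp (measurable_condEReal _)).add
    ((Complex.measurable_ofReal.comp (measurable_condEReal _)).mul_const _)

/-- `E(f) = E(p) - E(q)` for every decomposition `f = p - q` into nonnegative functions with finite
conditional expectations. -/
lemma condEReal_eq_of_eq_sub {f p q : X → ℝ} (hf : AEMeasurable f μ)
    (hp0 : ∀ x, 0 ≤ p x) (hq0 : ∀ x, 0 ≤ q x)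
    (hpE : ∀ᵐ x ∂μ, condLExp mA μ (fun y => ENNReal.ofReal (p y)) x < ∞)
    (hqE : ∀ᵐ x ∂μ, condLExp mA μ (fun y => ENNReal.ofReal (q y)) x < ∞)
    (h : ∀ x, f x = p x - q x) :
    condEReal mA μ f =ᵐ[μ] fun x =>
      (condLExp mA μ (fun y => ENNReal.ofReal (p y)) x).toReal -
        (condLExp mA μ (fun y => ENNReal.ofReal (q y)) x).toReal := by
  -- The identity `f = p - q` in subtraction-free form, `f⁺ + q = f⁻ + p`, to which additivity in
  -- `[0, ∞]` applies; finiteness is used only to subtract afterwards.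
  have e : (fun y => ENNReal.ofReal (f y) + ENNReal.ofReal (q y)) =
      fun y => ENNReal.ofReal (-f y) + ENNReal.ofReal (p y) := by
    ext y
    rcases le_total 0 (f y) with h0 | h0
    · rw [← ENNReal.ofReal_add h0 (hq0 y), ENNReal.ofReal_of_nonpos (neg_nonpos.2 h0), zero_add, h y]
      congr 1; ring
    · rw [← ENNReal.ofReal_add (by linarith) (hp0 y), ENNReal.ofReal_of_nonpos h0, zero_add, h y]
      congr 1; ring
  have m1 : (fun y => ENNReal.ofReal (f y)) ≤ᵐ[μ] fun y => ENNReal.ofReal (p y) :=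
    .of_forall fun y => ENNReal.ofReal_le_ofReal (by linarith [h y, hq0 y])
  have m2 : (fun y => ENNReal.ofReal (-f y)) ≤ᵐ[μ] fun y => ENNReal.ofReal (q y) :=
    .of_forall fun y => ENNReal.ofReal_le_ofReal (by linarith [h y, hp0 y])
  have a1 := condLExp_add (mA := mA) (μ := μ) (q := fun y => ENNReal.ofReal (q y)) hf.ennreal_ofReal
  have a2 := condLExp_add (mA := mA) (μ := μ) (q := fun y => ENNReal.ofReal (p y))
    hf.neg.ennreal_ofReal
  simp only [Pi.neg_apply] at a2
  rw [e] at a1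
  filter_upwards [a1, a2, hpE, hqE, condLExp_mono (mΩ := mA) m1, condLExp_mono (mΩ := mA) m2]
    with x a1 a2 hpx hqx m1 m2
  have l1 := m1.trans_lt hpx
  have l2 := m2.trans_lt hqx
  have := congrArg ENNReal.toReal (a1.symm.trans a2)
  rw [ENNReal.toReal_add l1.ne hqx.ne, ENNReal.toReal_add l2.ne hpx.ne] at this
  rw [condEReal]
  linarith

/-- `f` is a real measurable function with `E(|f|) < ∞` almost everywhere. -/
def CondIntegrable (mA : MeasurableSpace X) {mF : MeasurableSpace X} (μ : Measure X)
    (f : X → ℝ) : Prop :=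
  AEMeasurable f μ ∧ ∀ᵐ x ∂μ, condLExp mA μ (fun y => ‖f y‖ₑ) x < ∞

namespace CondIntegrable

variable {f g : X → ℝ}

lemma neg (hf : CondIntegrable mA μ f) : CondIntegrable mA μ (fun x => -f x) :=
  ⟨hf.1.neg, by simpa using hf.2⟩

lemma condLExp_ofReal_le (mA : MeasurableSpace X) {mF : MeasurableSpace X} {μ : Measure X}
    (f : X → ℝ) :
    ∀ᵐ x ∂μ, condLExp mA μ (fun y => ENNReal.ofReal (f y)) x ≤
      condLExp mA μ (fun y => ‖f y‖ₑ) x :=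
  condLExp_mono (.of_forall fun y => by
    dsimp only
    rw [Real.enorm_eq_ofReal_abs]; exact ENNReal.ofReal_le_ofReal (le_abs_self _))

lemma condLExp_ofReal_lt_top (hf : CondIntegrable mA μ f) :
    ∀ᵐ x ∂μ, condLExp mA μ (fun y => ENNReal.ofReal (f y)) x < ∞ := by
  filter_upwards [hf.2, condLExp_ofReal_le mA f] with x h1 h2 using h2.trans_lt h1

/-- The parts `(f + g)⁺` and `(f + g)⁻` are not additive, but `f + g = (f⁺ + g⁺) - (f⁻ + g⁻)` is an
admissible decomposition. -/
lemma condEReal_add (hf : CondIntegrable mA μ f) (hg : CondIntegrable mA μ g) :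
    condEReal mA μ (fun x => f x + g x) =ᵐ[μ]
      fun x => condEReal mA μ f x + condEReal mA μ g x := by
  have key {f g : X → ℝ} (hf : CondIntegrable mA μ f) (hg : CondIntegrable mA μ g) :
      condLExp mA μ (fun y => ENNReal.ofReal (max (f y) 0 + max (g y) 0)) =ᵐ[μ] fun x =>
        condLExp mA μ (fun y => ENNReal.ofReal (f y)) x +
          condLExp mA μ (fun y => ENNReal.ofReal (g y)) x := by
    refine .trans (.of_eq ?_) (condLExp_add hf.1.ennreal_ofReal)
    congr with y
    rw [ENNReal.ofReal_add (le_max_right _ _) (le_max_right _ _)]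
    simp [ENNReal.ofReal_max]
  have k1 := key hf hg
  have k2 := key hf.neg hg.neg
  have hf1 := hf.1
  have hg1 := hg.1
  have := condEReal_eq_of_eq_sub (mA := mA) (μ := μ) (f := fun x => f x + g x)
    (p := fun y => max (f y) 0 + max (g y) 0) (q := fun y => max (-f y) 0 + max (-g y) 0)
    (by fun_prop) (fun x => by positivity) (fun x => by positivity)
    (by filter_upwards [k1, hf.condLExp_ofReal_lt_top, hg.condLExp_ofReal_lt_top] with x h h1 h2
        rw [h]; exact ENNReal.add_lt_top.2 ⟨h1, h2⟩)
    (by filter_upwards [k2, hf.neg.condLExp_ofReal_lt_top, hg.neg.condLExp_ofReal_lt_top]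
          with x h h1 h2
        rw [h]; exact ENNReal.add_lt_top.2 ⟨h1, h2⟩)
    (fun x => by
      linarith [max_zero_sub_max_neg_zero_eq_self (f x), max_zero_sub_max_neg_zero_eq_self (g x)])
  filter_upwards [this, k1, k2, hf.condLExp_ofReal_lt_top, hg.condLExp_ofReal_lt_top,
    hf.neg.condLExp_ofReal_lt_top, hg.neg.condLExp_ofReal_lt_top] with x h k1 k2 h1 h2 h3 h4
  rw [h, k1, k2, ENNReal.toReal_add h1.ne h2.ne, ENNReal.toReal_add h3.ne h4.ne, condEReal,
    condEReal]
  ring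

lemma mul_left (hA : mA ≤ mF) [SigmaFinite (μ.trim hA)] {h : X → ℝ} (hh : Measurable[mA] h)
    (hf : CondIntegrable mA μ f) : CondIntegrable mA μ (fun x => h x * f x) := by
  refine ⟨(hh.mono hA le_rfl).aemeasurable.mul hf.1, ?_⟩
  simp_rw [enorm_mul]
  filter_upwards [condLExp_mul hA (measurable_enorm.comp hh) hf.1.enorm, hf.2] with x h1 h2
  refine h1.trans_lt ?_
  exact ENNReal.mul_lt_top enorm_lt_top h2

/-- Uses the decomposition `h f = (h⁺ f⁺ + h⁻ f⁻) - (h⁺ f⁻ + h⁻ f⁺)`; the second bracket is the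
first one with `-f` in place of `f`, so `key` covers both. -/
lemma condEReal_mul_left (hA : mA ≤ mF) [SigmaFinite (μ.trim hA)] {h : X → ℝ}
    (hh : Measurable[mA] h) (hf : CondIntegrable mA μ f) :
    condEReal mA μ (fun x => h x * f x) =ᵐ[μ] fun x => h x * condEReal mA μ f x := by
  have key {f : X → ℝ} (hf : CondIntegrable mA μ f) :
      condLExp mA μ (fun y => ENNReal.ofReal
          (max (h y) 0 * max (f y) 0 + max (-h y) 0 * max (-f y) 0)) =ᵐ[μ] fun x =>
        ENNReal.ofReal (h x) * condLExp mA μ (fun y => ENNReal.ofReal (f y)) x +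
          ENNReal.ofReal (-h x) * condLExp mA μ (fun y => ENNReal.ofReal (-f y)) x := by
    have e : (fun y => ENNReal.ofReal
          (max (h y) 0 * max (f y) 0 + max (-h y) 0 * max (-f y) 0)) = fun y =>
        ENNReal.ofReal (h y) * ENNReal.ofReal (f y) +
          ENNReal.ofReal (-h y) * ENNReal.ofReal (-f y) := by
      ext y
      rw [ENNReal.ofReal_add (by positivity) (by positivity),
        ENNReal.ofReal_mul (le_max_right _ _), ENNReal.ofReal_mul (le_max_right _ _)]
      simp [ENNReal.ofReal_max]
    have hh' := (hh.mono hA le_rfl).ennreal_ofReal.aemeasurable (μ := μ)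
    rw [e]
    filter_upwards [condLExp_add (mA := mA) (hh'.mul hf.1.ennreal_ofReal)
      (q := fun y => ENNReal.ofReal (-h y) * ENNReal.ofReal (-f y)),
      condLExp_mul hA hh.ennreal_ofReal hf.1.ennreal_ofReal,
      condLExp_mul hA (h := fun x => ENNReal.ofReal (-h x)) hh.neg.ennreal_ofReal hf.neg.1.ennreal_ofReal] with x h1 h2 h3
    refine h1.trans ?_
    rw [← h2, ← h3]
    rfl
  have k1 := key hf
  have k2 := key hf.neg
  simp only [neg_neg] at k2
  have hf1 := hf.1
  have hh1 := (hh.mono hA le_rfl).aemeasurable (μ := μ)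
  have t1 := hf.condLExp_ofReal_lt_top
  have t2 := hf.neg.condLExp_ofReal_lt_top
  have := condEReal_eq_of_eq_sub (mA := mA) (μ := μ) (f := fun x => h x * f x)
    (p := fun y => max (h y) 0 * max (f y) 0 + max (-h y) 0 * max (-f y) 0)
    (q := fun y => max (h y) 0 * max (-f y) 0 + max (-h y) 0 * max (f y) 0)
    (by fun_prop) (fun x => by positivity) (fun x => by positivity)
    (by filter_upwards [k1, t1, t2] with x h h1 h2
        rw [h]; finiteness)
    (by filter_upwards [k2, t1, t2] with x h h1 h2
        rw [h]; finiteness)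
    (fun x => by
      conv_lhs => rw [← max_zero_sub_max_neg_zero_eq_self (f x),
        ← max_zero_sub_max_neg_zero_eq_self (h x)]
      ring)
  filter_upwards [this, k1, k2, t1, t2] with x e k1 k2 t1 t2
  rw [e, k1, k2, ENNReal.toReal_add (by finiteness) (by finiteness),
    ENNReal.toReal_add (by finiteness) (by finiteness), condEReal]
  simp only [ENNReal.toReal_mul, ENNReal.toReal_ofReal']
  conv_rhs => rw [← max_zero_sub_max_neg_zero_eq_self (h x)]
  ring

lemma enorm_condEReal_le (hf : CondIntegrable mA μ f) :
    ∀ᵐ x ∂μ, ‖condEReal mA μ f x‖ₑ ≤ condLExp mA μ (fun y => ‖f y‖ₑ) x := by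
  have h := condLExp_ofReal_le mA (μ := μ) (fun y => -f y)
  simp only [enorm_neg] at h
  filter_upwards [hf.2, condLExp_ofReal_le mA f, h] with x h1 h2 h3
  have h4 := ENNReal.toReal_mono h1.ne h2
  have h5 := ENNReal.toReal_mono h1.ne h3
  rw [← ENNReal.ofReal_toReal h1.ne, Real.enorm_eq_ofReal_abs]
  refine ENNReal.ofReal_le_ofReal ?_
  rw [condEReal, abs_le]
  constructor <;> linarith [ENNReal.toReal_nonneg
    (a := condLExp mA μ (fun y => ENNReal.ofReal (f y)) x), ENNReal.toReal_nonneg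
    (a := condLExp mA μ (fun y => ENNReal.ofReal (-f y)) x)]

end CondIntegrable

namespace Conditionable

variable {f g : X → ℂ}

lemma re (hf : Conditionable mA μ f) : CondIntegrable mA μ (fun x => (f x).re) := by
  refine ⟨Complex.measurable_re.comp_aemeasurable hf.1.aemeasurable, ?_⟩
  have h : (fun y => ‖(f y).re‖ₑ) ≤ᵐ[μ] fun y => ‖f y‖ₑ :=
    .of_forall fun y => enorm_le_iff_norm_le.2 (Complex.abs_re_le_norm _)
  filter_upwards [condLExp_mono (mΩ := mA) h, hf.2] with x h1 h2 using h1.trans_lt h2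

lemma im (hf : Conditionable mA μ f) : CondIntegrable mA μ (fun x => (f x).im) := by
  refine ⟨Complex.measurable_im.comp_aemeasurable hf.1.aemeasurable, ?_⟩
  have h : (fun y => ‖(f y).im‖ₑ) ≤ᵐ[μ] fun y => ‖f y‖ₑ :=
    .of_forall fun y => enorm_le_iff_norm_le.2 (Complex.abs_im_le_norm _)
  filter_upwards [condLExp_mono (mΩ := mA) h, hf.2] with x h1 h2 using h1.trans_lt h2

lemma condE_add (hf : Conditionable mA μ f) (hg : Conditionable mA μ g) :
    condE mA μ (fun x => f x + g x) =ᵐ[μ] fun x => condE mA μ f x + condE mA μ g x := by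
  filter_upwards [hf.re.condEReal_add hg.re, hf.im.condEReal_add hg.im] with x h1 h2
  apply Complex.ext
  · exact h1
  · exact h2

/-- The pull-out property: `E(h f) = h E(f)` when `h` is `mA`-measurable. -/
lemma condE_mul_left (hA : mA ≤ mF) [SigmaFinite (μ.trim hA)] {h : X → ℂ}
    (hh : Measurable[mA] h) (hf : Conditionable mA μ f) :
    condE mA μ (fun x => h x * f x) =ᵐ[μ] fun x => h x * condE mA μ f x := by
  have hr : Measurable[mA] fun x => (h x).re := Complex.measurable_re.comp hh
  have hi : Measurable[mA] fun x => (h x).im := Complex.measurable_im.comp hh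
  have hi' : Measurable[mA] fun x => -(h x).im := measurable_neg.comp hi
  have e1 := (hf.re.mul_left hA hr).condEReal_add (hf.im.mul_left hA hi')
  have e2 := (hf.im.mul_left hA hr).condEReal_add (hf.re.mul_left hA hi)
  filter_upwards [e1, e2, hf.re.condEReal_mul_left hA hr, hf.im.condEReal_mul_left hA hi',
    hf.im.condEReal_mul_left hA hr, hf.re.condEReal_mul_left hA hi] with x e1 e2 h1 h2 h3 h4
  rw [h1, h2] at e1
  rw [h3, h4] at e2
  apply Complex.ext
  · simpa [condE, ← sub_eq_add_neg] using e1
  · simpa [condE] using e2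

/-- The factor `2` comes from bounding real and imaginary parts separately; it is not sharp, but
boundedness of `E M_u` does not need the best constant. -/
lemma enorm_condE_le (hf : Conditionable mA μ f) :
    ∀ᵐ x ∂μ, ‖condE mA μ f x‖ₑ ≤ 2 * condLExp mA μ (fun y => ‖f y‖ₑ) x := by
  have h1 : (fun y => ‖(f y).re‖ₑ) ≤ᵐ[μ] fun y => ‖f y‖ₑ :=
    .of_forall fun y => enorm_le_iff_norm_le.2 (Complex.abs_re_le_norm _)
  have h2 : (fun y => ‖(f y).im‖ₑ) ≤ᵐ[μ] fun y => ‖f y‖ₑ :=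
    .of_forall fun y => enorm_le_iff_norm_le.2 (Complex.abs_im_le_norm _)
  filter_upwards [condLExp_mono (mΩ := mA) h1, condLExp_mono (mΩ := mA) h2,
    hf.re.enorm_condEReal_le, hf.im.enorm_condEReal_le] with x h1 h2 h3 h4
  have h : ‖condE mA μ f x‖ₑ ≤ ‖(condE mA μ f x).re‖ₑ + ‖(condE mA μ f x).im‖ₑ := by
    rw [← ofReal_norm, ← ofReal_norm, ← ofReal_norm,
      ← ENNReal.ofReal_add (norm_nonneg _) (norm_nonneg _)]
    exact ENNReal.ofReal_le_ofReal (Complex.norm_le_abs_re_add_abs_im _)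
  rw [two_mul]
  exact h.trans (add_le_add (h3.trans h1) (h4.trans h2))

end Conditionable

/-! ### Conditional Cauchy-Schwarz inequality. -/

/-- Square-integrable `mA`-measurable minorants of `E(p q)` obey the conditional Cauchy-Schwarz
bound. -/
lemma lintegral_sq_le_of_le_condLExp (hA : mA ≤ mF) [SigmaFinite (μ.trim hA)]
    {p q b : X → ℝ≥0∞} {C : ℝ≥0∞}
    (hp : AEMeasurable p μ) (hq : AEMeasurable q μ) (hb : Measurable[mA] b)
    (hC : ∀ᵐ x ∂μ, condLExp mA μ (fun y => p y ^ 2) x ≤ C)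
    (hle : ∀ x, b x ≤ condLExp mA μ (fun y => p y * q y) x)
    (hfin : ∫⁻ x, b x ^ 2 ∂μ ≠ ∞) :
    ∫⁻ x, b x ^ 2 ∂μ ≤ C * ∫⁻ x, q x ^ 2 ∂μ := by
  have hb' : AEMeasurable b μ := (hb.mono hA le_rfl).aemeasurable
  set I := ∫⁻ x, b x ^ 2 ∂μ with hI
  set Q := ∫⁻ x, q x ^ 2 ∂μ with hQ
  have h1 : I ≤ ∫⁻ x, (b x * p x) * q x ∂μ := calc
    I ≤ ∫⁻ x, b x * condLExp mA μ (fun y => p y * q y) x ∂μ :=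
      lintegral_mono fun x => by rw [sq]; gcongr; exact hle x
    _ = ∫⁻ x, b x * (p x * q x) ∂μ := lintegral_mul_condLExp hA hb (hp.mul hq)
    _ = _ := by simp_rw [mul_assoc]
  have h2 : ∫⁻ x, (b x * p x) ^ 2 ∂μ ≤ C * I := calc
    ∫⁻ x, (b x * p x) ^ 2 ∂μ = ∫⁻ x, b x ^ 2 * p x ^ 2 ∂μ := by simp_rw [mul_pow]
    _ = ∫⁻ x, b x ^ 2 * condLExp mA μ (fun y => p y ^ 2) x ∂μ :=
      (lintegral_mul_condLExp hA (hb.pow_const 2) (hp.pow_const 2)).symm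
    _ ≤ ∫⁻ x, C * b x ^ 2 ∂μ := lintegral_mono_ae <| by
      filter_upwards [hC] with x hx
      rw [mul_comm]
      gcongr
    _ = C * I := lintegral_const_mul'' _ (hb'.pow_const 2)
  have h3 : I ≤ (C * I) ^ (1 / 2 : ℝ) * Q ^ (1 / 2 : ℝ) := by
    refine h1.trans ((ENNReal.lintegral_mul_le_Lp_mul_Lq μ Real.HolderConjugate.two_two
      (hb'.mul hp) hq).trans ?_)
    simp only [Pi.mul_apply, ENNReal.rpow_two]
    gcongr
  -- Squaring the Hölder bound leaves a common factor `I`, which may be cancelled because `hfin`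
  -- makes it finite.
  have h4 : I * I ≤ I * (C * Q) := by
    calc I * I ≤ ((C * I) ^ (1 / 2 : ℝ) * Q ^ (1 / 2 : ℝ)) *
          ((C * I) ^ (1 / 2 : ℝ) * Q ^ (1 / 2 : ℝ)) := mul_le_mul' h3 h3
      _ = ((C * I * Q) ^ (1 / 2 : ℝ)) ^ (2 : ℝ) := by
        rw [← ENNReal.mul_rpow_of_nonneg _ _ (by norm_num), ENNReal.rpow_two, sq]
      _ = I * (C * Q) := by
        rw [← ENNReal.rpow_mul]
        norm_num
        ring
  rcases eq_or_ne I 0 with h0 | h0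
  · rw [h0]; exact zero_le
  · exact (ENNReal.mul_le_mul_iff_right h0 hfin).1 h4

/-- If `E(p ^ 2) ≤ C`, then `∫ E(p q) ^ 2 ≤ C ∫ q ^ 2`. -/
lemma lintegral_condLExp_mul_sq_le (hA : mA ≤ mF) [SigmaFinite (μ.trim hA)]
    {p q : X → ℝ≥0∞} {C : ℝ≥0∞} (hp : AEMeasurable p μ) (hq : AEMeasurable q μ)
    (hC : ∀ᵐ x ∂μ, condLExp mA μ (fun y => p y ^ 2) x ≤ C) :
    ∫⁻ x, condLExp mA μ (fun y => p y * q y) x ^ 2 ∂μ ≤ C * ∫⁻ x, q x ^ 2 ∂μ := by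
  set a := condLExp mA μ (fun y => p y * q y) with ha
  have ham : Measurable[mA] a := measurable_condLExp mA μ _
  -- Truncating `E(p q)` at height `n` on the `n`-th spanning set of the trimmed measure gives
  -- `mA`-measurable minorants with finite square integral; Fatou's lemma then passes to the limit.
  let s : ℕ → Set X := @spanningSets X mA (μ.trim hA) _
  have hs (n : ℕ) : MeasurableSet[mA] (s n) := @measurableSet_spanningSets X mA (μ.trim hA) _ n
  let b : ℕ → X → ℝ≥0∞ := fun n => (s n).indicator fun x => min (a x) n
  have hb (n : ℕ) : Measurable[mA] (b n) := (ham.min measurable_const).indicator (hs n)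
  have hbound (n : ℕ) : ∫⁻ x, b n x ^ 2 ∂μ ≤ C * ∫⁻ x, q x ^ 2 ∂μ := by
    refine lintegral_sq_le_of_le_condLExp hA hp hq (hb n) hC (fun x => ?_) ?_
    · exact (Set.indicator_le_self' (fun _ _ => zero_le) x).trans (min_le_left _ _)
    · have hμ : μ (s n) < ∞ := by
        rw [← trim_measurableSet_eq hA (hs n)]
        exact @measure_spanningSets_lt_top X mA (μ.trim hA) _ n
      have : ∫⁻ x, b n x ^ 2 ∂μ ≤ ∫⁻ x, (s n).indicator (fun _ => (n : ℝ≥0∞) ^ 2) x ∂μ := by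
        refine lintegral_mono fun x => ?_
        by_cases hx : x ∈ s n
        · simp only [b, Set.indicator_of_mem hx]
          gcongr
          exact min_le_right _ _
        · simp [b, hx]
      rw [lintegral_indicator (hA _ (hs n)), setLIntegral_const] at this
      exact (this.trans_lt (by finiteness)).ne
  have hlim (x : X) : Tendsto (fun n => b n x ^ 2) atTop (𝓝 (a x ^ 2)) := by
    have hx : ∀ᶠ n : ℕ in atTop, min (a x) n = b n x := by
      obtain ⟨N, hN⟩ := Set.mem_iUnion.1
        ((@iUnion_spanningSets X mA (μ.trim hA) _).symm ▸ Set.mem_univ x)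
      filter_upwards [eventually_ge_atTop N] with n hn
      have hxn : x ∈ s n := @monotone_spanningSets X mA (μ.trim hA) _ _ _ hn x hN
      simp [b, hxn]
    have h := (tendsto_const_nhds (x := a x)).min ENNReal.tendsto_nat_nhds_top
    rw [min_eq_left le_top] at h
    exact ((ENNReal.continuous_pow 2).tendsto _).comp (h.congr' hx)
  calc ∫⁻ x, a x ^ 2 ∂μ = ∫⁻ x, liminf (fun n => b n x ^ 2) atTop ∂μ := by
        simp_rw [fun x => (hlim x).liminf_eq]
    _ ≤ liminf (fun n => ∫⁻ x, b n x ^ 2 ∂μ) atTop :=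
        lintegral_liminf_le fun n => ((hb n).mono hA le_rfl).pow_const 2
    _ ≤ C * ∫⁻ x, q x ^ 2 ∂μ := by
        refine (liminf_le_liminf (v := fun _ => C * ∫⁻ x, q x ^ 2 ∂μ) (.of_forall hbound)).trans ?_
        simp

lemma eLpNorm_two_eq (f : X → ℂ) :
    eLpNorm f 2 μ = (∫⁻ x, ‖f x‖ₑ ^ 2 ∂μ) ^ (1 / 2 : ℝ) := by
  simp [eLpNorm_eq_lintegral_rpow_enorm_toReal]

/-! ### The operator `E M_u` on `L²` and majorization. -/

section Operator

variable {u : X → ℂ} {C : ℝ≥0∞}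

lemma lintegral_condLExp_enorm_mul_sq_le (hA : mA ≤ mF) [SigmaFinite (μ.trim hA)]
    (hu : AEStronglyMeasurable u μ)
    (hC : ∀ᵐ x ∂μ, condLExp mA μ (fun y => ‖u y‖ₑ ^ 2) x ≤ C) (f : Lp ℂ 2 μ) :
    ∫⁻ x, condLExp mA μ (fun y => ‖u y * f y‖ₑ) x ^ 2 ∂μ ≤ C * ∫⁻ x, ‖f x‖ₑ ^ 2 ∂μ := by
  simp_rw [enorm_mul]
  exact lintegral_condLExp_mul_sq_le hA hu.enorm (Lp.aestronglyMeasurable f).enorm hC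

lemma lintegral_enorm_sq_lt_top (f : Lp ℂ 2 μ) : ∫⁻ x, ‖f x‖ₑ ^ 2 ∂μ < ∞ := by
  have h := (Lp.memLp f).2
  rw [eLpNorm_two_eq] at h
  exact (ENNReal.rpow_lt_top_iff_of_pos (by norm_num)).1 h

/-- By Cauchy-Schwarz `E(|u f|) ^ 2` has finite integral, so it is finite almost everywhere. -/
lemma conditionable_mul (hA : mA ≤ mF) [SigmaFinite (μ.trim hA)]
    (hu : AEStronglyMeasurable u μ) (hC' : C < ∞)
    (hC : ∀ᵐ x ∂μ, condLExp mA μ (fun y => ‖u y‖ₑ ^ 2) x ≤ C) (f : Lp ℂ 2 μ) :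
    Conditionable mA μ (fun x => u x * f x) := by
  refine ⟨hu.mul (Lp.aestronglyMeasurable f), ?_⟩
  have h := (lintegral_condLExp_enorm_mul_sq_le hA hu hC f).trans_lt
    (ENNReal.mul_lt_top hC' (lintegral_enorm_sq_lt_top f))
  filter_upwards [ae_lt_top ((measurable_condLExp' mA μ _).pow_const 2) h.ne] with x hx
  simpa using hx

lemma eLpNorm_condE_mul_le (hA : mA ≤ mF) [SigmaFinite (μ.trim hA)]
    (hu : AEStronglyMeasurable u μ) (hC' : C < ∞)
    (hC : ∀ᵐ x ∂μ, condLExp mA μ (fun y => ‖u y‖ₑ ^ 2) x ≤ C) (f : Lp ℂ 2 μ) :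
    eLpNorm (condE mA μ fun x => u x * f x) 2 μ ≤ (4 * C) ^ (1 / 2 : ℝ) * eLpNorm f 2 μ := by
  rw [eLpNorm_two_eq, eLpNorm_two_eq, ← ENNReal.mul_rpow_of_nonneg _ _ (by norm_num)]
  gcongr
  calc ∫⁻ x, ‖condE mA μ (fun x => u x * f x) x‖ₑ ^ 2 ∂μ
      ≤ ∫⁻ x, 4 * condLExp mA μ (fun y => ‖u y * f y‖ₑ) x ^ 2 ∂μ := lintegral_mono_ae <| by
        filter_upwards [(conditionable_mul hA hu hC' hC f).enorm_condE_le] with x hx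
        calc _ ≤ (2 * condLExp mA μ (fun y => ‖u y * f y‖ₑ) x) ^ 2 := by gcongr
          _ = _ := by rw [mul_pow]; norm_num
    _ = 4 * ∫⁻ x, condLExp mA μ (fun y => ‖u y * f y‖ₑ) x ^ 2 ∂μ :=
        lintegral_const_mul _ ((measurable_condLExp' mA μ _).pow_const 2)
    _ ≤ 4 * C * ∫⁻ x, ‖f x‖ₑ ^ 2 ∂μ := by
        rw [mul_assoc]
        gcongr
        exact lintegral_condLExp_enorm_mul_sq_le hA hu hC f

/-- `E M_u` is a bounded operator on `L²` when `E(|u| ^ 2)` is essentially bounded. -/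
lemma exists_isWCE_one (hA : mA ≤ mF) [SigmaFinite (μ.trim hA)]
    (hu : AEStronglyMeasurable u μ) (hC' : C < ∞)
    (hC : ∀ᵐ x ∂μ, condLExp mA μ (fun y => ‖u y‖ₑ ^ 2) x ≤ C) :
    ∃ A : Lp ℂ 2 μ →L[ℂ] Lp ℂ 2 μ, IsWCE mA μ (fun _ => 1) u A := by
  have hcond := conditionable_mul hA hu hC' hC
  have hbd := eLpNorm_condE_mul_le hA hu hC' hC
  have hK : (4 * C) ^ (1 / 2 : ℝ) < ∞ := by finiteness
  have hmem (f : Lp ℂ 2 μ) : MemLp (condE mA μ fun x => u x * f x) 2 μ :=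
    ⟨((measurable_condE _).mono hA le_rfl).aestronglyMeasurable,
      (hbd f).trans_lt (ENNReal.mul_lt_top hK (Lp.memLp f).2)⟩
  let L : Lp ℂ 2 μ →ₗ[ℂ] Lp ℂ 2 μ :=
    { toFun := fun f => (hmem f).toLp _
      map_add' := fun f g => by
        apply Lp.ext
        have h : (fun x => u x * (f + g : Lp ℂ 2 μ) x) =ᵐ[μ] fun x => u x * f x + u x * g x := by
          filter_upwards [Lp.coeFn_add f g] with x hx
          rw [hx, Pi.add_apply, mul_add]
        filter_upwards [(hmem (f + g)).coeFn_toLp, (hmem f).coeFn_toLp, (hmem g).coeFn_toLp,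
          Lp.coeFn_add ((hmem f).toLp _) ((hmem g).toLp _), condE_congr_ae (mA := mA) h,
          (hcond f).condE_add (hcond g)] with x h1 h2 h3 h4 h5 h6
        rw [h1, h4, Pi.add_apply, h2, h3, h5, h6]
      map_smul' := fun c f => by
        apply Lp.ext
        have h : (fun x => u x * (c • f : Lp ℂ 2 μ) x) =ᵐ[μ] fun x => c * (u x * f x) := by
          filter_upwards [Lp.coeFn_smul c f] with x hx
          rw [hx, Pi.smul_apply, smul_eq_mul, mul_left_comm]
        filter_upwards [(hmem (c • f)).coeFn_toLp, (hmem f).coeFn_toLp,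
          Lp.coeFn_smul c ((hmem f).toLp _), condE_congr_ae (mA := mA) h,
          (hcond f).condE_mul_left hA (measurable_const (a := c))] with x h1 h2 h3 h4 h5
        rw [h1, RingHom.id_apply, h3, Pi.smul_apply, h2, h4, h5, smul_eq_mul] }
  refine ⟨L.mkContinuous ((4 * C) ^ (1 / 2 : ℝ)).toReal fun f => ?_, fun f => ⟨hcond f, ?_⟩⟩
  · change ‖(hmem f).toLp _‖ ≤ _
    rw [Lp.norm_toLp, Lp.norm_def, ← ENNReal.toReal_mul]
    exact ENNReal.toReal_mono (ENNReal.mul_lt_top hK (Lp.memLp f).2).ne (hbd f)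
  · simp only [one_mul]
    exact (hmem f).coeFn_toLp

/-- If `E(u)` is bounded below, every `f ∈ L²` has the same image under `E M_u` as some `g ∈ L²`
with `δ ‖g‖ ≤ ‖E(u f)‖`. -/
lemma IsWCE.exists_norm_le (hA : mA ≤ mF) [SigmaFinite (μ.trim hA)]
    (hu : Conditionable mA μ u) {A : Lp ℂ 2 μ →L[ℂ] Lp ℂ 2 μ} (hAu : IsWCE mA μ (fun _ => 1) u A)
    {δ : ℝ} (hδ : 0 < δ) (hlow : ∀ᵐ x ∂μ, δ ≤ ‖condE mA μ u x‖) (f : Lp ℂ 2 μ) :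
    ∃ g : Lp ℂ 2 μ, ‖g‖ ≤ δ⁻¹ * ‖A f‖ ∧
      condE mA μ (fun x => u x * g x) =ᵐ[μ] condE mA μ fun x => u x * f x := by
  -- The quotient `E(u f) / E(u)`; the convention `0⁻¹ = 0` matters only on a null set, by `hlow`.
  let g : X → ℂ := fun x => condE mA μ (fun y => u y * f y) x * (condE mA μ u x)⁻¹
  have hgA : Measurable[mA] g := (measurable_condE _).mul (measurable_inv.comp (measurable_condE _))
  have hle : ∀ᵐ x ∂μ, ‖g x‖ ≤ δ⁻¹ * ‖A f x‖ := by
    filter_upwards [hlow, (hAu f).2] with x h1 h2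
    rw [h2, one_mul, norm_mul, norm_inv, mul_comm]
    gcongr
  have hg : MemLp g 2 μ := (Lp.memLp (A f)).of_le_mul
    (hgA.mono hA le_rfl).aestronglyMeasurable hle
  refine ⟨hg.toLp g, ?_, ?_⟩
  · refine Lp.norm_le_mul_norm_of_ae_le_mul ?_
    filter_upwards [hle, hg.coeFn_toLp] with x h1 h2
    rwa [h2]
  · have h : (fun x => u x * hg.toLp g x) =ᵐ[μ] fun x => g x * u x := by
      filter_upwards [hg.coeFn_toLp] with x hx
      rw [hx, mul_comm]
    filter_upwards [condE_congr_ae (mA := mA) h, hu.condE_mul_left hA hgA, hlow] with x h1 h2 h3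
    have h0 : condE mA μ u x ≠ 0 := norm_pos_iff.1 (hδ.trans_le h3)
    rw [h1, h2, inv_mul_cancel_right₀ h0]

/-- `E M_u` majorizes every operator vanishing on the kernel of `M_w E M_u`, as soon as `E(u)` is
bounded below. -/
lemma IsWCE.majorizes (hA : mA ≤ mF) [SigmaFinite (μ.trim hA)] {w : X → ℂ}
    (hu : Conditionable mA μ u) {A T S : Lp ℂ 2 μ →L[ℂ] Lp ℂ 2 μ}
    (hAu : IsWCE mA μ (fun _ => 1) u A) (hT : IsWCE mA μ w u T)
    {δ : ℝ} (hδ : 0 < δ) (hlow : ∀ᵐ x ∂μ, δ ≤ ‖condE mA μ u x‖)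
    (hS : ∀ f, T f = 0 → S f = 0) : Majorizes A S := by
  -- The `+ 1` keeps the constant positive when `S = 0`.
  refine ⟨(‖S‖ + 1) * δ⁻¹, by positivity, fun f => ?_⟩
  obtain ⟨g, hg, hfg⟩ := hAu.exists_norm_le hA hu hδ hlow f
  have hTfg : T (f - g) = 0 := by
    rw [map_sub, sub_eq_zero]
    apply Lp.ext
    filter_upwards [(hT f).2, (hT g).2, hfg] with x h1 h2 h3
    rw [h1, h2, h3]
  have hSfg : S f = S g := sub_eq_zero.1 (by rw [← map_sub]; exact hS _ hTfg)
  calc ‖S f‖ = ‖S g‖ := by rw [hSfg]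
    _ ≤ ‖S‖ * ‖g‖ := S.le_opNorm g
    _ ≤ (‖S‖ + 1) * (δ⁻¹ * ‖A f‖) := by gcongr; linarith
    _ = _ := by rw [mul_assoc]

end Operator

end CondExp

end SpectralRadiusAlgebra

theorem mainTheorem9 {X : Type*} {mF : MeasurableSpace X} (μ : Measure[mF] X) [SigmaFinite μ]
    (mA : MeasurableSpace X) (hA : mA ≤ mF) [SigmaFinite (μ.trim hA)]
    (w u : X → ℂ)
    (hw : SpectralRadiusAlgebra.Conditionable mA μ w)
    (hu : SpectralRadiusAlgebra.Conditionable mA μ u)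
    (hu_bdd : essSup (condLExp mA μ (fun x => ‖u x‖ₑ ^ 2)) μ < ∞)
    (T : Lp ℂ 2 μ →L[ℂ] Lp ℂ 2 μ) (hT : SpectralRadiusAlgebra.IsWCE mA μ w u T)
    (hu_nonneg : ∀ᵐ x ∂μ, 0 ≤ u x)
    (δ : ℝ) (hδ : 0 < δ)
    (hu_lower : ∀ᵐ x ∂μ, (δ : ℂ) ≤ SpectralRadiusAlgebra.condE mA μ u x) :
    ∃ A : Lp ℂ 2 μ →L[ℂ] Lp ℂ 2 μ,
      SpectralRadiusAlgebra.IsWCE mA μ (fun _ => 1) u A ∧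
      ∀ S ∈ SpectralRadiusAlgebra.Qset T, SpectralRadiusAlgebra.Majorizes A S := by
  obtain ⟨A, hAu⟩ := SpectralRadiusAlgebra.exists_isWCE_one hA hu.1 hu_bdd
    (ENNReal.ae_le_essSup _)
  refine ⟨A, hAu, fun S hS => ?_⟩
  have hlow : ∀ᵐ x ∂μ, δ ≤ ‖SpectralRadiusAlgebra.condE mA μ u x‖ := by
    filter_upwards [hu_lower] with x hx
    -- The order on `ℂ` compares real parts and requires equal imaginary parts, so the bound passes
    -- to the real part and then to the modulus.
    have h1 : δ ≤ (SpectralRadiusAlgebra.condE mA μ u x).re := by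
      simpa using (Complex.le_def.1 hx).1
    exact h1.trans (Complex.re_le_norm _)
  exact hAu.majorizes hA hu hT hδ hlow fun f hf =>
    SpectralRadiusAlgebra.apply_eq_zero_of_mem_Qset hS hf
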